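/- **Theorem (Confidence regions for the symmetric difference).** Let $\mathcal{S}$ be a compact metric space, $(\Omega,\mathcal{F},\mathbb{P})$ a probability space with outer and inner probability $\mathbb{P}^*[B]=\inf\{\mathbb{P}[A]:A\supseteq B,\ A\in\mathcal{F}\}$ and $\mathbb{P}_*[B]=1-\mathbb{P}^*[\Omega\setminus B]$, and let $\tau_n>0$ with $\tau_n\to 0$. Let $\gamma^1,\gamma^2:\mathcal{S}\to\mathbb{R}$ be continuous, let $\hat\gamma^1_n,\hat\gamma^2_n:\Omega\to\ell^\infty(\mathcal{S})$ be arbitrary (not necessarily measurable) maps into the space of bounded functions with the supremum norm, and let $J^1,J^2:\Omega\to C(\mathcal{S},\mathbb{R})$ be Borel measurable. Assume the functional central limit theorem $$\big(\tau_n^{-1}(\hat\gamma^1_n-\gamma^1),\ \tau_n^{-1}(\hat\gamma^2_n-\gamma^2)\big)\xrightarrow{d}(J^1,J^2)\quad\text{in }\ell^\infty(\mathcal{S})^2,$$ jointly and in the Hoffmann-Jørgensen sense, i.e. the outer expectations of $f$ applied to the left-hand side converge to $\mathbb{E}[f(J^1,J^2)]$ for every bounded continuous $f:\ell^\infty(\mathcal{S})^2\to\mathbb{R}$.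 For real functions $f,g$ on $\mathcal{S}$ put $(f\Delta g)(s)=\max\big(\min(-f(s),g(s)),\min(f(s),-g(s))\big)$, and let $\mu=\gamma^1\Delta\gamma^2$. For $\rho\in\{-1,0,1\}^2$ let $$V_\rho=\{s:\operatorname{sgn}(\gamma^1(s)-\gamma^2(s))=\rho_1,\ \operatorname{sgn}(\gamma^1(s)+\gamma^2(s))=\rho_2\},$$ $$\mathfrak{u}^+_\rho=\bigcap_{\eta>0}\overline{\overline{\mu^{-1}([0,\eta])}\cap V_\rho},\qquad \mathfrak{u}^-_\rho=\bigcap_{\eta>0}\overline{\overline{\mu^{-1}([-\eta,0])}\cap V_\rho},\qquad \mathcal{N}=\bigcup_{\kappa\in\{-1,1\}^2}V_{(0,0)}\cap\overline{V_\kappa}.$$ For $i\in\{1,2\}$ and $k\in\{-1,1\}$ let $$T_i^k=\mathfrak{u}^-_{((3-2i)k,\,-k)}\cup\mathfrak{u}^+_{((2i-3)k,\,k)}\cup\mathfrak{u}^-_{(0,\,-k)}\cup\mathfrak{u}^+_{((2i-3)k,\,0)}\cup\mathcal{N},$$ $$R_1=\mu^{-1}(0)\cap\big(V_{(-1,1)}\cup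 V_{(1,-1)}\big),\qquad R_2=\mu^{-1}(0)\cap\big(V_{(1,1)}\cup V_{(-1,-1)}\big).$$ For $q\in\mathbb{R}$ let $\mathcal{L}=\{\mu<0\}$, $\mathcal{U}=\{\mu>0\}$, $\hat{\mathcal{L}}=\{\tau_n^{-1}(\hat\gamma^1_n\Delta\hat\gamma^2_n)<-q\}$ and $\hat{\mathcal{U}}=\{\tau_n^{-1}(\hat\gamma^1_n\Delta\hat\gamma^2_n)>q\}$. Suprema over the empty set are $-\infty$. Then for every $q\in\mathbb{R}$: $$(i)\quad\liminf_{n\to\infty}\mathbb{P}_*\big[\hat{\mathcal{L}}\subseteq\mathcal{L}\wedge\hat{\mathcal{U}}\subseteq\mathcal{U}\big]\ \ge\ \mathbb{P}\Big[\max\Big(\max_{i\in\{1,2\},\,k\in\{-1,1\}}\ \sup_{s\in T_i^k}kJ^i(s),\ \sup_{s\in V_{(0,0)}\setminus\mathcal{N}}|(J^1\Delta J^2)(s)|\Big)<q\Big],$$ $$(ii)\quad\limsup_{n\to\infty}\mathbb{P}^*\big[\hat{\mathcal{L}}\subseteq\mathcal{L}\wedge\hat{\mathcal{U}}\subseteq\mathcal{U}\big]\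 \le\ \mathbb{P}\Big[\max\Big(\max_{i\in\{1,2\}}\ \sup_{s\in R_i}|J^i(s)|,\ \sup_{s\in V_{(0,0)}}|(J^1\Delta J^2)(s)|\Big)\le q\Big].$$ -/

import Mathlib

open Set Filter Topology MeasureTheory
open scoped ENNReal BoundedContinuousFunction

namespace SymDiffCR

noncomputable section

/-! ### Outer and inner probability, outer expectation, weak convergence -/

/-- Outer probability of an arbitrary subset `B` of the sample space:
the infimum of the probabilities of the measurable sets containing `B`. -/
def outerProb {Ω : Type*} [MeasurableSpace Ω] (P : Measure Ω) (B : Set Ω) : ℝ≥0∞ :=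
  ⨅ (A : Set Ω) (_ : MeasurableSet A) (_ : B ⊆ A), P A

/-- Inner probability of an arbitrary subset of the sample space. -/
def innerProb {Ω : Type*} [MeasurableSpace Ω] (P : Measure Ω) (B : Set Ω) : ℝ≥0∞ :=
  1 - outerProb P Bᶜ

/-- Outer expectation of an arbitrary (possibly non-measurable) *bounded* function `T`:
the infimum of the expectations of the integrable measurable majorants of `T`. -/
def outerExpectation {Ω : Type*} [MeasurableSpace Ω] (P : Measure Ω) (T : Ω → ℝ) : ℝ :=
  sInf {e : ℝ | ∃ U : Ω → ℝ, Measurable U ∧ Integrable U P ∧ (∀ ω, T ω ≤ U ω) ∧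
    e = ∫ ω, U ω ∂P}

/-- Weak convergence in the sense of Hoffmann-Jørgensen: the maps `X n` are arbitrary, the limit
`Y` is Borel measurable, and the outer expectations of `f (X n)` converge to the expectation of
`f Y` for every bounded continuous real function `f`. -/
def WeaklyConverges {Ω D : Type*} [MeasurableSpace Ω] [TopologicalSpace D] (P : Measure Ω)
    (X : ℕ → Ω → D) (Y : Ω → D) : Prop :=
  (∀ B : Set D, MeasurableSet[borel D] B → MeasurableSet (Y ⁻¹' B)) ∧
    ∀ f : D →ᵇ ℝ, Tendsto (fun n => outerExpectation P (fun ω => f (X n ω))) atTop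
      (𝓝 (∫ ω, f (Y ω) ∂P))

/-! ### Bounded functions on the spatial domain -/

/-- The Banach space of all bounded real functions on `S`, with the supremum norm. -/
abbrev Linf (S : Type*) : Type _ := lp (fun _ : S => ℝ) ∞

/-- A continuous function on a compact space, viewed as a bounded function. -/
def toLinf {S : Type*} [MetricSpace S] [CompactSpace S] (f : C(S, ℝ)) : Linf S :=
  ⟨fun s => f s, memℓp_infty ⟨‖f‖, by rintro _ ⟨s, rfl⟩; exact f.norm_coe_le_norm s⟩⟩

/-- The normalised estimation error `τ⁻¹ (γ̂ - γ)` of a pair of functions (the index `0 : Fin 2`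
stands for the first signal and `1 : Fin 2` for the second one). The space
`Fin 2 → Linf S` carries the maximum of the two supremum norms. -/
def errorProcess {S : Type*} [MetricSpace S] [CompactSpace S] (τ : ℝ) (γhat : Fin 2 → Linf S)
    (γ : Fin 2 → C(S, ℝ)) : Fin 2 → Linf S :=
  fun i => τ⁻¹ • (γhat i - toLinf (γ i))

/-- The symmetric difference `f Δ g` of two real functions. -/
def symDiff {S : Type*} (f g : S → ℝ) (s : S) : ℝ :=
  max (min (-f s) (g s)) (min (f s) (-g s))

/-! ### Sets entering the bounds -/

/-- The element `V_ρ` of the partition, indexed by the signs of `γ¹ - γ²` and `γ¹ + γ²`. -/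
def V {S : Type*} (γ : Fin 2 → S → ℝ) (ρ : SignType × SignType) : Set S :=
  {s | SignType.sign (γ 0 s - γ 1 s) = ρ.1 ∧ SignType.sign (γ 0 s + γ 1 s) = ρ.2}

/-- The set `𝔲⁺` for a target function `μ` and a partition element `W`. -/
def uPlus {S : Type*} [TopologicalSpace S] (μ : S → ℝ) (W : Set S) : Set S :=
  ⋂ (η : ℝ) (_ : 0 < η), closure (closure (μ ⁻¹' Icc 0 η) ∩ W)

/-- The set `𝔲⁻` for a target function `μ` and a partition element `W`. -/
def uMinus {S : Type*} [TopologicalSpace S] (μ : S → ℝ) (W : Set S) : Set S :=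
  ⋂ (η : ℝ) (_ : 0 < η), closure (closure (μ ⁻¹' Icc (-η) 0) ∩ W)

/-- The exceptional set `𝒩`. -/
def N {S : Type*} [TopologicalSpace S] (γ : Fin 2 → S → ℝ) : Set S :=
  ⋃ κ ∈ ({-1, 1} : Set SignType) ×ˢ ({-1, 1} : Set SignType), V γ (0, 0) ∩ closure (V γ κ)

/-- The sign `ε_i`: `+1` for the first and `-1` for the second signal. -/
def eps : Fin 2 → SignType := ![1, -1]

/-- The set `T_i^k`, for `i` one of the two signals and `k = ±1`. -/
def T {S : Type*} [TopologicalSpace S] (γ : Fin 2 → S → ℝ) (i : Fin 2) (k : SignType) : Set S :=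
  uMinus (symDiff (γ 0) (γ 1)) (V γ (eps i * k, -k)) ∪
  uPlus (symDiff (γ 0) (γ 1)) (V γ (-eps i * k, k)) ∪
  uMinus (symDiff (γ 0) (γ 1)) (V γ (0, -k)) ∪
  uPlus (symDiff (γ 0) (γ 1)) (V γ (-eps i * k, 0)) ∪
  N γ

/-- The sets `R_1` (for `i = 0`) and `R_2` (for `i = 1`). -/
def R {S : Type*} (γ : Fin 2 → S → ℝ) : Fin 2 → Set S :=
  ![symDiff (γ 0) (γ 1) ⁻¹' {0} ∩ (V γ (-1, 1) ∪ V γ (1, -1)),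
    symDiff (γ 0) (γ 1) ⁻¹' {0} ∩ (V γ (1, 1) ∪ V γ (-1, -1))]

/-! ### Excursion sets, confidence regions and the inclusion event -/

/-- The set where `μ` is negative. -/
def lowerSet {S : Type*} (μ : S → ℝ) : Set S := {s | μ s < 0}

/-- The set where `μ` is positive. -/
def upperSet {S : Type*} (μ : S → ℝ) : Set S := {s | 0 < μ s}

/-- The lower confidence region based on the estimator `μhat`. -/
def lowerCR {S : Type*} (τ q : ℝ) (μhat : S → ℝ) : Set S := {s | τ⁻¹ * μhat s < -q}

/-- The upper confidence region based on the estimator `μhat`. -/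
def upperCR {S : Type*} (τ q : ℝ) (μhat : S → ℝ) : Set S := {s | q < τ⁻¹ * μhat s}

/-- The event that both confidence regions are included in the sets they estimate. -/
def inclusionEvent {S Ω : Type*} (τ q : ℝ) (γ : Fin 2 → S → ℝ) (γhat : Ω → Fin 2 → Linf S) :
    Set Ω :=
  {ω | lowerCR τ q (symDiff (γhat ω 0) (γhat ω 1)) ⊆ lowerSet (symDiff (γ 0) (γ 1)) ∧
       upperCR τ q (symDiff (γhat ω 0) (γhat ω 1)) ⊆ upperSet (symDiff (γ 0) (γ 1))}

/-- The statistic in the lower bound, with values in the extended reals (so that the supremum over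
an empty set is `-∞`), for a pair `J` of functions. -/
def lowerBoundStat {S : Type*} [TopologicalSpace S] (γ J : Fin 2 → S → ℝ) : EReal :=
  max (⨆ (i : Fin 2) (k ∈ ({-1, 1} : Set SignType)) (s ∈ T γ i k), (((k : ℝ) * J i s : ℝ) : EReal))
    (⨆ s ∈ V γ (0, 0) \ N γ, ((|symDiff (J 0) (J 1) s| : ℝ) : EReal))

/-- The statistic in the upper bound. -/
def upperBoundStat {S : Type*} (γ J : Fin 2 → S → ℝ) : EReal :=
  max (⨆ (i : Fin 2) (s ∈ R γ i), ((|J i s| : ℝ) : EReal))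
    (⨆ s ∈ V γ (0, 0), ((|symDiff (J 0) (J 1) s| : ℝ) : EReal))

end

end SymDiffCR

namespace SymDiffCR

/-! ### The portmanteau inequality for outer probabilities -/

section Portmanteau

variable {Ω D : Type*} [MeasurableSpace Ω] (P : Measure Ω)

/-! Write `X n` for the error process and `A n` for the set of errors for which both inclusions
hold. The portmanteau inequality extends to varying sets: `limsup P*(X n ∈ A n) ≤ P(Y ∈ L)`, where
`L` is the upper closed limit of the `A n` (`WeaklyConverges.limsup_outerProb_le`). Applied to `A n`
it gives (ii); applied to the complements it gives (i). What remains is deterministic: which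
continuous `j` are limits of errors `h k ∈ A (φ k)`, or of errors outside these sets, with `φ k →
∞`?

With `a = γ 0 - γ 1` and `b = γ 0 + γ 1` the symmetric difference is `(|a| - |b|) / 2`, so its
perturbation only involves absolute values of `a + t u` and `b + t v`, with `u`, `v` the difference
and sum of the errors.

For (ii), inclusion forces the perturbed symmetric difference to be at most `q t` in modulus at each
zero of `μ`, and expanding there gives the statistic. For (i), failure yields witnesses `x k`; along
an ultrafilter they converge to some `s`, with constant signs of `a`, `b` and one fixed kind of
failure. Since `t → 0`, `|a| = |b|` at `s`, so `s` lies in the `𝔲` set of that sign pattern.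
First-order expansion bounds `q` above by a term of the statistic; where `a` and `b` vanish at `s`
without a determined expansion, `s ∈ 𝒩` and a triangle inequality suffices. -/

theorem outerProb_mono {A B : Set Ω} (h : A ⊆ B) : outerProb P A ≤ outerProb P B :=
  le_iInf fun C => le_iInf fun hC => le_iInf fun hBC =>
    iInf_le_of_le C (iInf_le_of_le hC (iInf_le_of_le (h.trans hBC) le_rfl))

/-- Markov's inequality at level 1 for every measurable majorant of `T`, followed by the infimum
over majorants. -/
theorem outerProb_le_ofReal_outerExpectation [IsProbabilityMeasure P] {T : Ω → ℝ} {B : Set Ω}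
    {c : ℝ} (hT0 : ∀ ω, 0 ≤ T ω) (hTc : ∀ ω, T ω ≤ c) (hTB : ∀ ω ∈ B, 1 ≤ T ω) :
    outerProb P B ≤ ENNReal.ofReal (outerExpectation P T) := by
  have hbound : ∀ U : Ω → ℝ, Measurable U → Integrable U P → (∀ ω, T ω ≤ U ω) →
      outerProb P B ≤ ENNReal.ofReal (∫ ω, U ω ∂P) := by
    intro U hU hUi hTU
    have hmarkov := mul_meas_ge_le_integral_of_nonneg
      (ae_of_all P fun ω => (hT0 ω).trans (hTU ω)) hUi 1
    rw [one_mul] at hmarkov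
    have hsub : B ⊆ {ω | 1 ≤ U ω} := fun ω hω => (hTB ω hω).trans (hTU ω)
    calc outerProb P B ≤ P {ω | 1 ≤ U ω} :=
          iInf_le_of_le _ (iInf_le_of_le (measurableSet_le measurable_const hU)
            (iInf_le_of_le hsub le_rfl))
      _ = ENNReal.ofReal (P.real {ω | 1 ≤ U ω}) := by simp
      _ ≤ _ := ENNReal.ofReal_le_ofReal hmarkov
  have hfin : outerProb P B ≠ ∞ :=
    ne_top_of_le_ne_top ENNReal.ofReal_ne_top
      (hbound (fun _ => c) measurable_const (integrable_const c) hTc)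
  rw [← ENNReal.ofReal_toReal hfin]
  -- The constant `c` shows that there are majorants; the real infimum of an empty set would be the
  -- default value 0.
  refine ENNReal.ofReal_le_ofReal (le_csInf
    ⟨_, fun _ => c, measurable_const, integrable_const c, hTc, rfl⟩ ?_)
  rintro e ⟨U, hU, hUi, hTU, rfl⟩
  exact ENNReal.toReal_le_of_le_ofReal (integral_nonneg fun ω => (hT0 ω).trans (hTU ω))
    (hbound U hU hUi hTU)

variable {P} [PseudoMetricSpace D] {X : ℕ → Ω → D} {Y : Ω → D}

/-- The thickened indicators of `K` are continuous, bounded by 1 and equal to 1 on `K`, so each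
dominates the limsup; their expectations at `Y` decrease to the probability of `K`. -/
theorem WeaklyConverges.limsup_outerProb_le_of_isClosed [IsProbabilityMeasure P]
    (h : WeaklyConverges P X Y) {K : Set D}
    (hK : IsClosed K) :
    limsup (fun n => outerProb P (X n ⁻¹' K)) atTop ≤ P (Y ⁻¹' K) := by
  let _ : MeasurableSpace D := borel D
  have : BorelSpace D := ⟨rfl⟩
  have hY : Measurable Y := fun B hB => h.1 B hB
  have : IsProbabilityMeasure (P.map Y) := Measure.isProbabilityMeasure_map hY.aemeasurable
  have hδ : ∀ n : ℕ, (0 : ℝ) < 1 / (n + 1) := fun n => Nat.one_div_pos_of_nat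
  have hlim := tendsto_lintegral_thickenedIndicator_of_isClosed (P.map Y) hK hδ
    tendsto_one_div_add_atTop_nhds_zero_nat
  rw [Measure.map_apply hY hK.measurableSet] at hlim
  refine ge_of_tendsto' hlim fun m => ?_
  set g := thickenedIndicator (hδ m) K
  have hg1 : ∀ x, ((g x : NNReal) : ℝ) ≤ 1 := fun x =>
    NNReal.coe_le_one.2 (thickenedIndicator_le_one (hδ m) K x)
  let f : D →ᵇ ℝ := BoundedContinuousFunction.ofNormedAddCommGroup (fun x => ((g x : NNReal) : ℝ))
    (NNReal.continuous_coe.comp g.continuous) 1 (fun x => by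
      rw [Real.norm_of_nonneg (NNReal.coe_nonneg _)]; exact hg1 x)
  have hgm : Measurable fun x => ((g x : NNReal) : ℝ) :=
    (NNReal.continuous_coe.comp g.continuous).measurable
  have hint : Integrable (fun ω => ((g (Y ω) : NNReal) : ℝ)) P :=
    Integrable.of_bound (hgm.comp hY).aestronglyMeasurable 1 (ae_of_all _ fun ω => by
      rw [Real.norm_of_nonneg (NNReal.coe_nonneg _)]; exact hg1 _)
  have hval : ∫⁻ x, (g x : ℝ≥0∞) ∂(P.map Y) = ENNReal.ofReal (∫ ω, f (Y ω) ∂P) := by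
    rw [lintegral_map (g.continuous.measurable.coe_nnreal_ennreal) hY]
    exact lintegral_coe_eq_integral (fun ω => g (Y ω)) hint
  rw [hval, ← ((ENNReal.continuous_ofReal.tendsto _).comp (h.2 f)).limsup_eq]
  refine limsup_le_limsup (Eventually.of_forall fun n => ?_)
  refine outerProb_le_ofReal_outerExpectation P (c := 1) (fun ω => NNReal.coe_nonneg _)
    (fun ω => hg1 _) fun ω hω => ?_
  have : g (X n ω) = 1 := thickenedIndicator_one (hδ m) K hω
  change (1 : ℝ) ≤ ((g (X n ω) : NNReal) : ℝ)
  rw [this, NNReal.coe_one]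

/-- The upper closed limit of a sequence of sets. -/
def upperClosedLimit {D : Type*} [TopologicalSpace D] (A : ℕ → Set D) : Set D :=
  ⋂ m : ℕ, closure (⋃ n ≥ m, A n)

theorem WeaklyConverges.measurableSet_preimage_upperClosedLimit (h : WeaklyConverges P X Y)
    (A : ℕ → Set D) : MeasurableSet (Y ⁻¹' upperClosedLimit A) := by
  refine h.1 _ ?_
  let _ : MeasurableSpace D := borel D
  have : BorelSpace D := ⟨rfl⟩
  exact MeasurableSet.iInter fun _ => isClosed_closure.measurableSet

/-- For `n ≥ m` the set `A n` lies in the fixed closed set `closure (⋃ n ≥ m, A n)`. The closed case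
applies to it, and continuity from above lets `m → ∞`. -/
theorem WeaklyConverges.limsup_outerProb_le [IsProbabilityMeasure P]
    (h : WeaklyConverges P X Y) (A : ℕ → Set D) :
    limsup (fun n => outerProb P (X n ⁻¹' A n)) atTop ≤ P (Y ⁻¹' upperClosedLimit A) := by
  let _ : MeasurableSpace D := borel D
  have : BorelSpace D := ⟨rfl⟩
  have hY : Measurable Y := fun B hB => h.1 B hB
  have hanti : Antitone fun m : ℕ => Y ⁻¹' closure (⋃ n ≥ m, A n) := fun m m' hm =>
    preimage_mono (closure_mono (iUnion₂_mono' fun n hn => ⟨n, hm.trans hn, Subset.rfl⟩))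
  have hlim := tendsto_measure_iInter_atTop (μ := P)
    (fun m => (hY isClosed_closure.measurableSet).nullMeasurableSet) hanti
    ⟨0, measure_ne_top P _⟩
  rw [upperClosedLimit, preimage_iInter]
  refine ge_of_tendsto' hlim fun m => ?_
  refine le_trans (limsup_le_limsup ?_) (h.limsup_outerProb_le_of_isClosed isClosed_closure)
  filter_upwards [eventually_ge_atTop m] with n hn
  exact outerProb_mono P (preimage_mono ((subset_iUnion₂ (s := fun n _ => A n) n hn).trans
    subset_closure))

theorem exists_seq_of_mem_upperClosedLimit {A : ℕ → Set D} {y : D}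
    (hy : y ∈ upperClosedLimit A) :
    ∃ (φ : ℕ → ℕ) (x : ℕ → D), Tendsto φ atTop atTop ∧ (∀ k, x k ∈ A (φ k)) ∧
      Tendsto x atTop (𝓝 y) := by
  have : ∀ k : ℕ, ∃ n x, k ≤ n ∧ x ∈ A n ∧ dist x y < 1 / ((k : ℝ) + 1) := by
    intro k
    obtain ⟨x, hx, hxy⟩ := Metric.mem_closure_iff.1 (mem_iInter.1 hy k) (1 / ((k : ℝ) + 1))
      Nat.one_div_pos_of_nat
    obtain ⟨n, hn, hxn⟩ := mem_iUnion₂.1 hx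
    exact ⟨n, x, hn, hxn, dist_comm x y ▸ hxy⟩
  choose φ x hφ hx hd using this
  exact ⟨φ, x, tendsto_atTop_mono hφ tendsto_id, hx, tendsto_iff_dist_tendsto_zero.2
    (squeeze_zero (fun _ => dist_nonneg) (fun k => (hd k).le)
      tendsto_one_div_add_atTop_nhds_zero_nat)⟩

end Portmanteau

end SymDiffCR

namespace SymDiffCR

/-! ### Asymptotics of differences of perturbed absolute values -/

section Asymptotics

variable {ι : Type*} {l : Filter ι} [l.NeBot] {a b u v t : ι → ℝ} {a₀ b₀ u₀ v₀ q : ℝ}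

theorem le_of_eventually_mul_lt_mul {w : ι → ℝ} {w₀ : ℝ} (ht : ∀ i, 0 < t i)
    (hw : Tendsto w l (𝓝 w₀)) (h : ∀ᶠ i in l, q * t i < t i * w i) : q ≤ w₀ := by
  refine ge_of_tendsto hw (h.mono fun i hi => ?_)
  rw [mul_comm] at hi
  exact (lt_of_mul_lt_mul_left hi (ht i).le).le

theorem abs_le_abs_of_eventually_lt (ha : Tendsto a l (𝓝 a₀)) (hb : Tendsto b l (𝓝 b₀))
    (hu : Tendsto u l (𝓝 u₀)) (hv : Tendsto v l (𝓝 v₀)) (ht₀ : Tendsto t l (𝓝 0))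
    (h : ∀ᶠ i in l, q * t i < |a i + t i * u i| - |b i + t i * v i|) : |b₀| ≤ |a₀| := by
  have h1 := (ha.add (ht₀.mul hu)).abs.sub (hb.add (ht₀.mul hv)).abs
  have h2 := le_of_tendsto_of_tendsto (ht₀.const_mul q) h1 (h.mono fun i hi => hi.le)
  simpa using h2

/-- Only the triangle inequality is used, so it applies near `𝒩`, where the signs of the perturbed
values are undetermined. -/
theorem le_abs_add_abs_of_eventually_lt (hu : Tendsto u l (𝓝 u₀)) (hv : Tendsto v l (𝓝 v₀))
    (ht : ∀ i, 0 < t i) (hab : ∀ᶠ i in l, |a i| ≤ |b i|)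
    (h : ∀ᶠ i in l, q * t i < |a i + t i * u i| - |b i + t i * v i|) : q ≤ |u₀| + |v₀| := by
  refine le_of_eventually_mul_lt_mul ht (hu.abs.add hv.abs) ?_
  filter_upwards [hab, h] with i h1 h2
  have h3 := abs_add_le (a i) (t i * u i)
  have h4 := abs_add_le (b i + t i * v i) (-(t i * v i))
  rw [add_neg_cancel_right, abs_neg] at h4
  rw [abs_mul, abs_of_pos (ht i)] at h3 h4
  linarith

theorem le_abs_sub_abs_of_eventually_lt (hu : Tendsto u l (𝓝 u₀)) (hv : Tendsto v l (𝓝 v₀))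
    (ht : ∀ i, 0 < t i) (ha : ∀ᶠ i in l, a i = 0) (hb : ∀ᶠ i in l, b i = 0)
    (h : ∀ᶠ i in l, q * t i < |a i + t i * u i| - |b i + t i * v i|) : q ≤ |u₀| - |v₀| := by
  refine le_of_eventually_mul_lt_mul ht (hu.abs.sub hv.abs) ?_
  filter_upwards [ha, hb, h] with i h1 h2 h3
  rw [h1, h2, zero_add, zero_add, abs_mul, abs_mul, abs_of_pos (ht i)] at h3
  linarith

theorem le_abs_sub_mul_of_eventually_lt {d : ℝ} (hu : Tendsto u l (𝓝 u₀))
    (hv : Tendsto v l (𝓝 v₀)) (ht : ∀ i, 0 < t i) (hd : |d| = 1)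
    (ha : ∀ᶠ i in l, a i = 0) (hb : ∀ᶠ i in l, |b i| = d * b i)
    (h : ∀ᶠ i in l, q * t i < |a i + t i * u i| - |b i + t i * v i|) : q ≤ |u₀| - d * v₀ := by
  refine le_of_eventually_mul_lt_mul ht (hu.abs.sub (hv.const_mul d)) ?_
  filter_upwards [ha, hb, h] with i h1 h2 h3
  rw [h1, zero_add, abs_mul, abs_of_pos (ht i)] at h3
  -- `|b + t v|` enters with a minus sign, so the bound `|b + t v| ≥ d (b + t v)` suffices and the
  -- limit of `b` may vanish.
  have h4 := le_abs_self (d * (b i + t i * v i))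
  rw [abs_mul, hd, one_mul] at h4
  linarith [abs_nonneg (b i)]

theorem le_mul_sub_mul_of_eventually_lt {c d : ℝ} (ha : Tendsto a l (𝓝 a₀))
    (hu : Tendsto u l (𝓝 u₀)) (hv : Tendsto v l (𝓝 v₀)) (ht : ∀ i, 0 < t i)
    (ht₀ : Tendsto t l (𝓝 0)) (hc : |c| = 1) (hd : |d| = 1) (ha₀ : a₀ ≠ 0)
    (hac : ∀ᶠ i in l, |a i| = c * a i) (hbd : ∀ᶠ i in l, |b i| = d * b i)
    (hab : ∀ᶠ i in l, |a i| ≤ |b i|)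
    (h : ∀ᶠ i in l, q * t i < |a i + t i * u i| - |b i + t i * v i|) :
    q ≤ c * u₀ - d * v₀ := by
  refine le_of_eventually_mul_lt_mul ht ((hu.const_mul c).sub (hv.const_mul d)) ?_
  -- Only `a` needs a nonzero limit: `|a + t u| = c (a + t u)` must eventually be an equality, while
  -- for `b` an inequality is enough.
  have hca : 0 < c * a₀ := by
    rw [← tendsto_nhds_unique_of_eventuallyEq ha.abs (ha.const_mul c) hac]
    exact abs_pos.2 ha₀
  have hlim : Tendsto (fun i => c * (a i + t i * u i)) l (𝓝 (c * a₀)) := by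
    simpa using (ha.add (ht₀.mul hu)).const_mul c
  filter_upwards [hac, hbd, hab, h, hlim.eventually_const_lt hca] with i h1 h2 h3 h4 h5
  have h6 := le_abs_self (d * (b i + t i * v i))
  rw [abs_mul, hd, one_mul] at h6
  have h7 := abs_of_pos h5
  rw [abs_mul, hc, one_mul] at h7
  linarith

end Asymptotics

/-- The coordinates `f - g` and `f + g` separate the nested max and min into two independent
absolute values; this is why `V` records their signs. -/
theorem symDiff_eq {S : Type*} (f g : S → ℝ) (s : S) :
    symDiff f g s = (|f s - g s| - |f s + g s|) / 2 := by
  unfold symDiff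
  rcases abs_cases (f s - g s) with h | h <;> rcases abs_cases (f s + g s) with h' | h' <;>
    rcases max_cases (min (-f s) (g s)) (min (f s) (-g s)) with h1 | h1 <;>
    rcases min_cases (-f s) (g s) with h2 | h2 <;>
    rcases min_cases (f s) (-g s) with h3 | h3 <;> linarith

theorem symDiff_add_mul {S : Type*} (f g h k : S → ℝ) (τ : ℝ) (s : S) :
    symDiff (fun x => f x + τ * h x) (fun x => g x + τ * k x) s =
      (|f s - g s + τ * (h s - k s)| - |f s + g s + τ * (h s + k s)|) / 2 := by
  rw [symDiff_eq]; ring_nf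

theorem abs_eq_sign_mul (x : ℝ) : |x| = (SignType.sign x : ℝ) * x := by
  rw [sign_mul_self]

theorem mem_V_zero_iff {S : Type*} {γ : Fin 2 → S → ℝ} {s : S} :
    s ∈ V γ (0, 0) ↔ γ 0 s - γ 1 s = 0 ∧ γ 0 s + γ 1 s = 0 := by
  simp [V, sign_eq_zero_iff]

/-! ### The sets entering the lower bound -/

section Sets

variable {S : Type*} [TopologicalSpace S] {γ J : Fin 2 → S → ℝ} {q : ℝ} {s : S}

theorem mul_lt_of_lowerBoundStat_lt (h : lowerBoundStat γ J < q) {i : Fin 2} {k : SignType}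
    (hk : k = -1 ∨ k = 1) (hs : s ∈ T γ i k) : (k : ℝ) * J i s < q := by
  have h1 := (max_lt_iff.1 h).1
  refine EReal.coe_lt_coe_iff.1 (lt_of_le_of_lt ?_ h1)
  exact le_iSup_of_le i (le_iSup_of_le k (le_iSup_of_le hk (le_iSup_of_le s
    (le_iSup_of_le hs le_rfl))))

theorem abs_symDiff_lt_of_lowerBoundStat_lt (h : lowerBoundStat γ J < q)
    (hs : s ∈ V γ (0, 0) \ N γ) : |symDiff (J 0) (J 1) s| < q := by
  have h1 := (max_lt_iff.1 h).2
  exact EReal.coe_lt_coe_iff.1 (lt_of_le_of_lt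
    (le_iSup₂ (f := fun s (_ : s ∈ V γ (0, 0) \ N γ) =>
      ((|symDiff (J 0) (J 1) s| : ℝ) : EReal)) s hs) h1)

theorem abs_lt_of_mem_N (h : lowerBoundStat γ J < q) (hs : s ∈ N γ) (i : Fin 2) :
    |J i s| < q := by
  have h1 := mul_lt_of_lowerBoundStat_lt h (i := i) (k := 1) (Or.inr rfl) (Or.inr hs)
  have h2 := mul_lt_of_lowerBoundStat_lt h (i := i) (k := -1) (Or.inl rfl) (Or.inr hs)
  simp only [SignType.coe_one, SignType.coe_neg, one_mul, neg_mul] at h1 h2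
  exact abs_lt.2 ⟨by linarith, h1⟩

/-- The statistic omits `𝒩` from its second supremum, but there both `|J i|` are already below `q`,
and the symmetric difference never exceeds them. -/
theorem abs_symDiff_lt_of_mem_V_zero (h : lowerBoundStat γ J < q) (hs : s ∈ V γ (0, 0)) :
    |symDiff (J 0) (J 1) s| < q := by
  by_cases hN : s ∈ N γ
  · have h0 := abs_lt.1 (abs_lt_of_mem_N h hN 0)
    have h1 := abs_lt.1 (abs_lt_of_mem_N h hN 1)
    rw [symDiff_eq, abs_lt]
    constructor <;> rcases abs_cases (J 0 s - J 1 s) with h2 | h2 <;>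
      rcases abs_cases (J 0 s + J 1 s) with h3 | h3 <;> linarith
  · exact abs_symDiff_lt_of_lowerBoundStat_lt h ⟨hs, hN⟩

theorem mem_T_of_mem_uMinus {i : Fin 2} {k : SignType} {ρ : SignType × SignType}
    (hs : s ∈ uMinus (symDiff (γ 0) (γ 1)) (V γ ρ)) (hρ : ρ = (eps i * k, -k) ∨ ρ = (0, -k)) :
    s ∈ T γ i k := by
  rcases hρ with rfl | rfl
  · exact Or.inl (Or.inl (Or.inl (Or.inl hs)))
  · exact Or.inl (Or.inl (Or.inr hs))

theorem mem_T_of_mem_uPlus {i : Fin 2} {k : SignType} {ρ : SignType × SignType}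
    (hs : s ∈ uPlus (symDiff (γ 0) (γ 1)) (V γ ρ)) (hρ : ρ = (-eps i * k, k) ∨ ρ = (-eps i * k, 0)) :
    s ∈ T γ i k := by
  rcases hρ with rfl | rfl
  · exact Or.inl (Or.inl (Or.inl (Or.inr hs)))
  · exact Or.inl (Or.inr hs)

variable {ι : Type*} {l : Filter ι} [l.NeBot] {x : ι → S} {μ : S → ℝ} {W : Set S}

theorem mem_uMinus_of_tendsto (hx : Tendsto x l (𝓝 s)) (hμ : Tendsto (fun i => μ (x i)) l (𝓝 0))
    (hle : ∀ᶠ i in l, μ (x i) ≤ 0) (hW : ∀ᶠ i in l, x i ∈ W) : s ∈ uMinus μ W := by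
  refine mem_iInter₂.2 fun η hη => mem_closure_of_tendsto hx ?_
  filter_upwards [hle, hW, hμ.eventually_const_lt (neg_lt_zero.2 hη)] with i h1 h2 h3
  exact ⟨subset_closure ⟨h3.le, h1⟩, h2⟩

theorem mem_uPlus_of_tendsto (hx : Tendsto x l (𝓝 s)) (hμ : Tendsto (fun i => μ (x i)) l (𝓝 0))
    (hle : ∀ᶠ i in l, 0 ≤ μ (x i)) (hW : ∀ᶠ i in l, x i ∈ W) : s ∈ uPlus μ W := by
  refine mem_iInter₂.2 fun η hη => mem_closure_of_tendsto hx ?_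
  filter_upwards [hle, hW, hμ.eventually_lt_const hη] with i h1 h2 h3
  exact ⟨subset_closure ⟨h1, h3.le⟩, h2⟩

theorem mem_N_of_tendsto {κ : SignType × SignType} (hκ : κ.1 ≠ 0 ∧ κ.2 ≠ 0)
    (hs : s ∈ V γ (0, 0)) (hx : Tendsto x l (𝓝 s)) (hV : ∀ᶠ i in l, x i ∈ V γ κ) : s ∈ N γ := by
  have hne : ∀ e : SignType, e ≠ 0 → e ∈ ({-1, 1} : Set SignType) := by
    intro e he; revert he; cases e <;> simp
  exact mem_iUnion₂.2 ⟨κ, ⟨hne _ hκ.1, hne _ hκ.2⟩, hs, mem_closure_of_tendsto hx hV⟩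

end Sets

end SymDiffCR

/-! ### Limit points of failures of inclusion -/

namespace SymDiffCR

section Limits

variable {S : Type*} [TopologicalSpace S] {γ J : Fin 2 → S → ℝ} {q : ℝ} {s : S}
  {ι : Type*} {l : Filter ι} [l.NeBot] {x : ι → S} {t : ι → ℝ} {h : ι → Fin 2 → ℝ}
  {ρ : SignType × SignType}

theorem le_lowerBoundStat_of_eventually_lt_of_symDiff_nonpos (hγ : ∀ m, Continuous (γ m))
    (ht : ∀ i, 0 < t i) (ht₀ : Tendsto t l (𝓝 0)) (hx : Tendsto x l (𝓝 s))
    (hh : ∀ m, Tendsto (fun i => h i m) l (𝓝 (J m s))) (hV : ∀ᶠ i in l, x i ∈ V γ ρ)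
    (hμ : ∀ᶠ i in l, symDiff (γ 0) (γ 1) (x i) ≤ 0)
    (hq : ∀ᶠ i in l, 2 * q * t i < |γ 0 (x i) - γ 1 (x i) + t i * (h i 0 - h i 1)| -
      |γ 0 (x i) + γ 1 (x i) + t i * (h i 0 + h i 1)|) :
    (q : EReal) ≤ lowerBoundStat γ J := by
  by_contra! hstat
  obtain ⟨r₁, r₂⟩ := ρ
  have hg : ∀ m, Tendsto (fun i => γ m (x i)) l (𝓝 (γ m s)) := fun m =>
    ((hγ m).tendsto s).comp hx
  have ha := (hg 0).sub (hg 1)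
  have hb := (hg 0).add (hg 1)
  have hu := (hh 0).sub (hh 1)
  have hv := (hh 0).add (hh 1)
  have hab : ∀ᶠ i in l, |γ 0 (x i) - γ 1 (x i)| ≤ |γ 0 (x i) + γ 1 (x i)| := by
    filter_upwards [hμ] with i hi
    rw [symDiff_eq] at hi
    linarith
  have hlim : |γ 0 s - γ 1 s| = |γ 0 s + γ 1 s| :=
    -- The sign of `μ` gives one inequality; the failure, whose perturbations vanish in the limit,
    -- gives the other.
    le_antisymm (le_of_tendsto_of_tendsto ha.abs hb.abs hab)
      (abs_le_abs_of_eventually_lt ha hb hu hv ht₀ hq)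
  have hμ₀ : Tendsto (fun i => symDiff (γ 0) (γ 1) (x i)) l (𝓝 0) := by
    simpa [symDiff_eq, hlim] using (ha.abs.sub hb.abs).div_const 2
  have hT : ∀ (m : Fin 2) (k : SignType), (k = -1 ∨ k = 1) →
      ((r₁, r₂) = (eps m * k, -k) ∨ (r₁, r₂) = (0, -k)) → (k : ℝ) * J m s < q :=
    fun m k hk hρ => mul_lt_of_lowerBoundStat_lt hstat hk
      (mem_T_of_mem_uMinus (mem_uMinus_of_tendsto hx hμ₀ hμ hV) hρ)
  have hac : ∀ᶠ i in l, |γ 0 (x i) - γ 1 (x i)| = (r₁ : ℝ) * (γ 0 (x i) - γ 1 (x i)) := by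
    filter_upwards [hV] with i hi
    rw [abs_eq_sign_mul, hi.1]
  have hbd : ∀ᶠ i in l, |γ 0 (x i) + γ 1 (x i)| = (r₂ : ℝ) * (γ 0 (x i) + γ 1 (x i)) := by
    filter_upwards [hV] with i hi
    rw [abs_eq_sign_mul, hi.2]
  have ha0 : r₁ = 0 → ∀ᶠ i in l, γ 0 (x i) - γ 1 (x i) = 0 := fun h0 =>
    hV.mono fun i hi => sign_eq_zero_iff.1 (hi.1.trans h0)
  have hb0 : r₂ = 0 → ∀ᶠ i in l, γ 0 (x i) + γ 1 (x i) = 0 := fun h0 =>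
    hV.mono fun i hi => sign_eq_zero_iff.1 (hi.2.trans h0)
  -- Otherwise `s ∈ 𝒩`, hence `|J i s| < q` for both `i`, against `2 q ≤ |J 0 s - J 1 s| + |J 0 s +
  -- J 1 s| = 2 max |J i s|`.
  have hN : r₁ ≠ 0 → r₂ ≠ 0 → γ 0 s - γ 1 s ≠ 0 := by
    intro h1 h2 h0
    have hsN : s ∈ N γ := mem_N_of_tendsto ⟨h1, h2⟩
      (mem_V_zero_iff.2 ⟨h0, by rwa [h0, abs_zero, eq_comm, abs_eq_zero] at hlim⟩) hx hV
    have h3 := le_abs_add_abs_of_eventually_lt hu hv ht hab hq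
    have h4 := abs_lt.1 (abs_lt_of_mem_N hstat hsN 0)
    have h5 := abs_lt.1 (abs_lt_of_mem_N hstat hsN 1)
    rcases abs_cases (J 0 s - J 1 s) with h6 | h6 <;>
      rcases abs_cases (J 0 s + J 1 s) with h7 | h7 <;> linarith
  by_cases h1 : r₁ = 0
  · by_cases h2 : r₂ = 0
    · have h3 := le_abs_sub_abs_of_eventually_lt hu hv ht (ha0 h1) (hb0 h2) hq
      have h4 : γ 0 s - γ 1 s = 0 :=
        tendsto_nhds_unique_of_eventuallyEq ha tendsto_const_nhds (ha0 h1)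
      have h5 : γ 0 s + γ 1 s = 0 :=
        tendsto_nhds_unique_of_eventuallyEq hb tendsto_const_nhds (hb0 h2)
      have h6 := abs_symDiff_lt_of_mem_V_zero hstat (mem_V_zero_iff.2 ⟨h4, h5⟩)
      rw [symDiff_eq] at h6
      linarith [le_abs_self ((|J 0 s - J 1 s| - |J 0 s + J 1 s|) / 2)]
    · subst h1
      -- With `k = -r₂`, `|J 0 s - J 1 s| - r₂ (J 0 s + J 1 s)` is twice the larger of `k J 0 s` and
      -- `k J 1 s`, so both signals are needed.
      have h0 := hT 0 (-r₂)
      have h1 := hT 1 (-r₂)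
      rcases SignType.trichotomy r₂ with rfl | rfl | rfl
      · have h3 := le_abs_sub_mul_of_eventually_lt hu hv ht (by simp) (ha0 rfl) hbd hq
        simp at h0 h1 h3
        rcases abs_cases (J 0 s - J 1 s) with h6 | h6 <;> linarith
      · exact h2 rfl
      · have h3 := le_abs_sub_mul_of_eventually_lt hu hv ht (by simp) (ha0 rfl) hbd hq
        simp at h0 h1 h3
        rcases abs_cases (J 0 s - J 1 s) with h6 | h6 <;> linarith
  · by_cases h2 : r₂ = 0
    · obtain ⟨i, h3, h4, h5⟩ := (hab.and ((hb0 h2).and hV)).exists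
      rw [h4, abs_zero, abs_nonpos_iff] at h3
      exact h1 (h5.1.symm.trans (sign_eq_zero_iff.2 h3))
    · have hcd : ∀ e : SignType, e ≠ 0 → |(e : ℝ)| = 1 := by
        intro e he
        rcases SignType.trichotomy e with rfl | rfl | rfl <;> simp_all
      have h3 := le_mul_sub_mul_of_eventually_lt ha hu hv ht ht₀ (hcd _ h1) (hcd _ h2)
        (hN h1 h2) hac hbd hab hq
      -- `r₁ (J 0 s - J 1 s) - r₂ (J 0 s + J 1 s)` equals `2 k J i s` with `k = -r₂`, where `i = 0`
      -- if `r₁ = -r₂` and `i = 1` if `r₁ = r₂`.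
      have h4 := hT 0 (-r₂)
      have h5 := hT 1 (-r₂)
      rcases SignType.trichotomy r₁ with rfl | rfl | rfl <;>
        rcases SignType.trichotomy r₂ with rfl | rfl | rfl <;> simp [eps] at h1 h2 h3 h4 h5 <;>
        linarith

/-- The mirror image of the nonpositive case: sum and difference exchange roles, and `𝔲⁺` replaces
`𝔲⁻`. -/
theorem le_lowerBoundStat_of_eventually_lt_of_symDiff_nonneg (hγ : ∀ m, Continuous (γ m))
    (ht : ∀ i, 0 < t i) (ht₀ : Tendsto t l (𝓝 0)) (hx : Tendsto x l (𝓝 s))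
    (hh : ∀ m, Tendsto (fun i => h i m) l (𝓝 (J m s))) (hV : ∀ᶠ i in l, x i ∈ V γ ρ)
    (hμ : ∀ᶠ i in l, 0 ≤ symDiff (γ 0) (γ 1) (x i))
    (hq : ∀ᶠ i in l, 2 * q * t i < |γ 0 (x i) + γ 1 (x i) + t i * (h i 0 + h i 1)| -
      |γ 0 (x i) - γ 1 (x i) + t i * (h i 0 - h i 1)|) :
    (q : EReal) ≤ lowerBoundStat γ J := by
  by_contra! hstat
  obtain ⟨r₁, r₂⟩ := ρ
  have hg : ∀ m, Tendsto (fun i => γ m (x i)) l (𝓝 (γ m s)) := fun m =>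
    ((hγ m).tendsto s).comp hx
  have ha := (hg 0).sub (hg 1)
  have hb := (hg 0).add (hg 1)
  have hu := (hh 0).sub (hh 1)
  have hv := (hh 0).add (hh 1)
  have hab : ∀ᶠ i in l, |γ 0 (x i) + γ 1 (x i)| ≤ |γ 0 (x i) - γ 1 (x i)| := by
    filter_upwards [hμ] with i hi
    rw [symDiff_eq] at hi
    linarith
  have hlim : |γ 0 s - γ 1 s| = |γ 0 s + γ 1 s| :=
    le_antisymm (abs_le_abs_of_eventually_lt hb ha hv hu ht₀ hq)
      (le_of_tendsto_of_tendsto hb.abs ha.abs hab)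
  have hμ₀ : Tendsto (fun i => symDiff (γ 0) (γ 1) (x i)) l (𝓝 0) := by
    simpa [symDiff_eq, hlim] using (ha.abs.sub hb.abs).div_const 2
  have hT : ∀ (m : Fin 2) (k : SignType), (k = -1 ∨ k = 1) →
      ((r₁, r₂) = (-eps m * k, k) ∨ (r₁, r₂) = (-eps m * k, 0)) → (k : ℝ) * J m s < q :=
    fun m k hk hρ => mul_lt_of_lowerBoundStat_lt hstat hk
      (mem_T_of_mem_uPlus (mem_uPlus_of_tendsto hx hμ₀ hμ hV) hρ)
  have hac : ∀ᶠ i in l, |γ 0 (x i) - γ 1 (x i)| = (r₁ : ℝ) * (γ 0 (x i) - γ 1 (x i)) := by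
    filter_upwards [hV] with i hi
    rw [abs_eq_sign_mul, hi.1]
  have hbd : ∀ᶠ i in l, |γ 0 (x i) + γ 1 (x i)| = (r₂ : ℝ) * (γ 0 (x i) + γ 1 (x i)) := by
    filter_upwards [hV] with i hi
    rw [abs_eq_sign_mul, hi.2]
  have ha0 : r₁ = 0 → ∀ᶠ i in l, γ 0 (x i) - γ 1 (x i) = 0 := fun h0 =>
    hV.mono fun i hi => sign_eq_zero_iff.1 (hi.1.trans h0)
  have hb0 : r₂ = 0 → ∀ᶠ i in l, γ 0 (x i) + γ 1 (x i) = 0 := fun h0 =>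
    hV.mono fun i hi => sign_eq_zero_iff.1 (hi.2.trans h0)
  have hN : r₁ ≠ 0 → r₂ ≠ 0 → γ 0 s + γ 1 s ≠ 0 := by
    intro h1 h2 h0
    have hsN : s ∈ N γ := mem_N_of_tendsto ⟨h1, h2⟩
      (mem_V_zero_iff.2 ⟨by rwa [h0, abs_zero, abs_eq_zero] at hlim, h0⟩) hx hV
    have h3 := le_abs_add_abs_of_eventually_lt hv hu ht hab hq
    have h4 := abs_lt.1 (abs_lt_of_mem_N hstat hsN 0)
    have h5 := abs_lt.1 (abs_lt_of_mem_N hstat hsN 1)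
    rcases abs_cases (J 0 s - J 1 s) with h6 | h6 <;>
      rcases abs_cases (J 0 s + J 1 s) with h7 | h7 <;> linarith
  by_cases h2 : r₂ = 0
  · by_cases h1 : r₁ = 0
    · have h3 := le_abs_sub_abs_of_eventually_lt hv hu ht (hb0 h2) (ha0 h1) hq
      have h4 : γ 0 s - γ 1 s = 0 :=
        tendsto_nhds_unique_of_eventuallyEq ha tendsto_const_nhds (ha0 h1)
      have h5 : γ 0 s + γ 1 s = 0 :=
        tendsto_nhds_unique_of_eventuallyEq hb tendsto_const_nhds (hb0 h2)
      have h6 := abs_symDiff_lt_of_mem_V_zero hstat (mem_V_zero_iff.2 ⟨h4, h5⟩)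
      rw [symDiff_eq] at h6
      linarith [neg_abs_le ((|J 0 s - J 1 s| - |J 0 s + J 1 s|) / 2)]
    · subst h2
      -- `|J 0 s + J 1 s| - r₁ (J 0 s - J 1 s)` is twice the larger of `-r₁ J 0 s` and `r₁ J 1 s`:
      -- the two signals carry opposite `k`.
      have h0 := hT 0 (-r₁)
      have h2 := hT 1 r₁
      rcases SignType.trichotomy r₁ with rfl | rfl | rfl
      · have h3 := le_abs_sub_mul_of_eventually_lt hv hu ht (by simp) (hb0 rfl) hac hq
        simp [eps] at h0 h2 h3
        rcases abs_cases (J 0 s + J 1 s) with h6 | h6 <;> linarith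
      · exact h1 rfl
      · have h3 := le_abs_sub_mul_of_eventually_lt hv hu ht (by simp) (hb0 rfl) hac hq
        simp [eps] at h0 h2 h3
        rcases abs_cases (J 0 s + J 1 s) with h6 | h6 <;> linarith
  · by_cases h1 : r₁ = 0
    · obtain ⟨i, h3, h4, h5⟩ := (hab.and ((ha0 h1).and hV)).exists
      rw [h4, abs_zero, abs_nonpos_iff] at h3
      exact h2 (h5.2.symm.trans (sign_eq_zero_iff.2 h3))
    · have hcd : ∀ e : SignType, e ≠ 0 → |(e : ℝ)| = 1 := by
        intro e he
        rcases SignType.trichotomy e with rfl | rfl | rfl <;> simp_all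
      have h3 := le_mul_sub_mul_of_eventually_lt hb hv hu ht ht₀ (hcd _ h2) (hcd _ h1)
        (hN h1 h2) hbd hac hab hq
      have h4 := hT 0 r₂
      have h5 := hT 1 r₂
      rcases SignType.trichotomy r₁ with rfl | rfl | rfl <;>
        rcases SignType.trichotomy r₂ with rfl | rfl | rfl <;> simp [eps] at h1 h2 h3 h4 h5 <;>
        linarith

end Limits

end SymDiffCR

namespace SymDiffCR

/-! ### The inclusion event as a condition on the error process -/

/-- Difference and sum have equal modulus and opposite signs, so they add up to zero. -/
theorem eq_zero_and_ne_zero_of_mem_R_zero {S : Type*} {γ : Fin 2 → S → ℝ} {s : S}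
    (hs : s ∈ R γ 0) : γ 0 s = 0 ∧ γ 1 s ≠ 0 := by
  obtain ⟨h, ⟨h1, h2⟩ | ⟨h1, h2⟩⟩ := hs <;> rw [mem_preimage, mem_singleton_iff, symDiff_eq] at h
  · rw [sign_eq_neg_one_iff] at h1
    rw [sign_eq_one_iff] at h2
    rw [abs_of_neg h1, abs_of_pos h2] at h
    exact ⟨by linarith, by intro; linarith⟩
  · rw [sign_eq_one_iff] at h1
    rw [sign_eq_neg_one_iff] at h2
    rw [abs_of_pos h1, abs_of_neg h2] at h
    exact ⟨by linarith, by intro; linarith⟩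

theorem eq_zero_and_ne_zero_of_mem_R_one {S : Type*} {γ : Fin 2 → S → ℝ} {s : S}
    (hs : s ∈ R γ 1) : γ 1 s = 0 ∧ γ 0 s ≠ 0 := by
  obtain ⟨h, ⟨h1, h2⟩ | ⟨h1, h2⟩⟩ := hs <;> rw [mem_preimage, mem_singleton_iff, symDiff_eq] at h
  · rw [sign_eq_one_iff] at h1 h2
    rw [abs_of_pos h1, abs_of_pos h2] at h
    exact ⟨by linarith, by intro; linarith⟩
  · rw [sign_eq_neg_one_iff] at h1 h2
    rw [abs_of_neg h1, abs_of_neg h2] at h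
    exact ⟨by linarith, by intro; linarith⟩

section Inclusion

variable {S : Type*} [MetricSpace S] [CompactSpace S]

/-- The errors for which both confidence regions are included in the sets they estimate. -/
def inclusionSet (τ q : ℝ) (γ : Fin 2 → C(S, ℝ)) : Set (Fin 2 → Linf S) :=
  inclusionEvent τ q (fun i => ⇑(γ i)) (fun h i => toLinf (γ i) + τ • h i)

theorem errorProcess_preimage_inclusionSet {Ω : Type*} {τ : ℝ} (hτ : 0 < τ) (q : ℝ)
    (γ : Fin 2 → C(S, ℝ)) (γhat : Ω → Fin 2 → Linf S) :
    (fun ω => errorProcess τ (γhat ω) γ) ⁻¹' inclusionSet τ q γ =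
      inclusionEvent τ q (fun i => ⇑(γ i)) γhat := by
  have h : ∀ ω i, toLinf (γ i) + τ • errorProcess τ (γhat ω) γ i = γhat ω i := by
    intro ω i
    rw [errorProcess, smul_inv_smul₀ hτ.ne', add_sub_cancel]
  ext ω
  simp only [inclusionSet, inclusionEvent, mem_preimage, mem_ofPred_eq, h]

theorem symDiff_toLinf_add (τ : ℝ) (γ : Fin 2 → C(S, ℝ)) (h : Fin 2 → Linf S) (s : S) :
    symDiff (⇑(toLinf (γ 0) + τ • h 0)) (⇑(toLinf (γ 1) + τ • h 1)) s =
      (|γ 0 s - γ 1 s + τ * (h 0 s - h 1 s)| - |γ 0 s + γ 1 s + τ * (h 0 s + h 1 s)|) / 2 :=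
  symDiff_add_mul (γ 0) (γ 1) (h 0) (h 1) τ s

/-- Uniform convergence to a continuous limit permits evaluation at moving points, although the `h
i` need not be continuous. -/
theorem tendsto_apply_of_tendsto_toLinf {ι : Type*} {l : Filter ι} {h : ι → Linf S} {j : C(S, ℝ)}
    {x : ι → S} {s : S} (hh : Tendsto h l (𝓝 (toLinf j))) (hx : Tendsto x l (𝓝 s)) :
    Tendsto (fun i => h i (x i)) l (𝓝 (j s)) := by
  have h1 : Tendsto (fun i => h i (x i) - j (x i)) l (𝓝 0) :=
    squeeze_zero_norm (fun i => lp.norm_apply_le_norm ENNReal.top_ne_zero (h i - toLinf j) (x i))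
      (tendsto_iff_norm_sub_tendsto_zero.1 hh)
  simpa using h1.add ((j.continuous.tendsto s).comp hx)

variable {τ : ℕ → ℝ} {q : ℝ} {γ j : Fin 2 → C(S, ℝ)}

theorem le_lowerBoundStat_of_mem_upperClosedLimit (hτ : ∀ n, 0 < τ n)
    (hτ₀ : Tendsto τ atTop (𝓝 0))
    (hj : (fun i => toLinf (j i)) ∈ upperClosedLimit fun n => (inclusionSet (τ n) q γ)ᶜ) :
    (q : EReal) ≤ lowerBoundStat (fun i => ⇑(γ i)) (fun i => ⇑(j i)) := by
  obtain ⟨φ, h, hφ, hmem, hh⟩ := exists_seq_of_mem_upperClosedLimit hj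
  have hex : ∀ k, ∃ s,
      (symDiff (γ 0) (γ 1) s ≤ 0 ∧
        2 * q * τ (φ k) < |γ 0 s - γ 1 s + τ (φ k) * (h k 0 s - h k 1 s)| -
          |γ 0 s + γ 1 s + τ (φ k) * (h k 0 s + h k 1 s)|) ∨
      (0 ≤ symDiff (γ 0) (γ 1) s ∧
        2 * q * τ (φ k) < |γ 0 s + γ 1 s + τ (φ k) * (h k 0 s + h k 1 s)| -
          |γ 0 s - γ 1 s + τ (φ k) * (h k 0 s - h k 1 s)|) := by
    intro k
    have h1 := hmem k
    simp only [inclusionSet, inclusionEvent, lowerCR, upperCR, lowerSet, upperSet, mem_compl_iff,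
      mem_ofPred_eq, not_and_or, Set.not_subset, not_lt, symDiff_toLinf_add] at h1
    rcases h1 with ⟨s, h2, h3⟩ | ⟨s, h2, h3⟩
    · rw [inv_mul_lt_iff₀ (hτ _)] at h2
      exact ⟨s, Or.inr ⟨h3, by linarith⟩⟩
    · rw [lt_inv_mul_iff₀ (hτ _)] at h2
      exact ⟨s, Or.inl ⟨h3, by linarith⟩⟩
  choose x hx using hex
  -- An ultrafilter replaces successive subsequences: it makes the `x k` converge by compactness and
  -- settles both the sign pattern and the kind of failure, as these are finite choices.
  let U : Ultrafilter ℕ := hyperfilter ℕ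
  have hU : (U : Filter ℕ) ≤ atTop := Nat.hyperfilter_le_atTop
  obtain ⟨s, -, hs⟩ := isCompact_univ.ultrafilter_le_nhds (U.map x) (by simp)
  have hxs : Tendsto x U (𝓝 s) := hs
  have hht : ∀ m, Tendsto (fun k => h k m (x k)) U (𝓝 (j m s)) := fun m =>
    tendsto_apply_of_tendsto_toLinf ((tendsto_pi_nhds.1 hh m).mono_left hU) hxs
  obtain ⟨ρ, hρ⟩ : ∃ ρ, ∀ᶠ k in U, x k ∈ V (fun i => ⇑(γ i)) ρ :=
    Ultrafilter.eventually_exists_iff.1 (Eventually.of_forall fun k => ⟨(_, _), rfl, rfl⟩)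
  have hτU : Tendsto (fun k => τ (φ k)) U (𝓝 0) := (hτ₀.comp hφ).mono_left hU
  have hγ : ∀ m, Continuous (γ m) := fun m => (γ m).continuous
  rcases Ultrafilter.eventually_or.1 (Eventually.of_forall (f := (U : Filter ℕ)) hx) with h1 | h1
  · exact le_lowerBoundStat_of_eventually_lt_of_symDiff_nonpos hγ (fun k => hτ (φ k)) hτU hxs
      (h := fun k m => h k m (x k)) hht hρ (h1.mono fun _ => And.left) (h1.mono fun _ => And.right)
  · exact le_lowerBoundStat_of_eventually_lt_of_symDiff_nonneg hγ (fun k => hτ (φ k)) hτU hxs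
      (h := fun k m => h k m (x k)) hht hρ (h1.mono fun _ => And.left) (h1.mono fun _ => And.right)

/-- At a zero of the first of two functions where the second one does not vanish, the difference
of the perturbed absolute values is asymptotically linear. -/
theorem abs_le_of_eventually_abs_le {ι : Type*} {l : Filter ι} [l.NeBot] {t f g : ι → ℝ}
    {y f₀ g₀ : ℝ} (ht : ∀ i, 0 < t i) (ht₀ : Tendsto t l (𝓝 0)) (hf : Tendsto f l (𝓝 f₀))
    (hg : Tendsto g l (𝓝 g₀)) (hy : y ≠ 0)
    (h : ∀ᶠ i in l, |(|y + t i * (f i - g i)| - |y + t i * (f i + g i)|)| ≤ 2 * q * t i) :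
    |g₀| ≤ q := by
  refine le_of_tendsto hg.abs ?_
  -- Since `y * y > 0`, both perturbed values eventually have the sign of `y`, and the absolute
  -- values open with the same sign.
  have h1 : Tendsto (fun i => y * (y + t i * (f i - g i))) l (𝓝 (y * y)) := by
    simpa using ((ht₀.mul (hf.sub hg)).const_add y).const_mul y
  have h2 : Tendsto (fun i => y * (y + t i * (f i + g i))) l (𝓝 (y * y)) := by
    simpa using ((ht₀.mul (hf.add hg)).const_add y).const_mul y
  have hyy : 0 < y * y := mul_self_pos.2 hy
  filter_upwards [h, h1.eventually_const_lt hyy, h2.eventually_const_lt hyy] with i h3 h4 h5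
  have key : |(|y + t i * (f i - g i)| - |y + t i * (f i + g i)|)| = 2 * (t i * |g i|) := by
    have h6 : 2 * (t i * |g i|) = |2 * (t i * g i)| := by
      rw [abs_mul, abs_mul, abs_two, abs_of_pos (ht i)]
    rw [h6]
    rcases lt_or_gt_of_ne hy with hy' | hy'
    · rw [abs_of_neg ((neg_iff_neg_of_mul_pos h4).1 hy'),
        abs_of_neg ((neg_iff_neg_of_mul_pos h5).1 hy')]
      congr 1; ring
    · rw [abs_of_pos ((pos_iff_pos_of_mul_pos h4).1 hy'),
        abs_of_pos ((pos_iff_pos_of_mul_pos h5).1 hy'), ← abs_neg]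
      congr 1; ring
  rw [key] at h3
  exact le_of_mul_le_mul_left (by linarith) (ht i)

theorem upperBoundStat_le_of_mem_upperClosedLimit (hτ : ∀ n, 0 < τ n)
    (hτ₀ : Tendsto τ atTop (𝓝 0))
    (hj : (fun i => toLinf (j i)) ∈ upperClosedLimit fun n => inclusionSet (τ n) q γ) :
    upperBoundStat (fun i => ⇑(γ i)) (fun i => ⇑(j i)) ≤ (q : EReal) := by
  obtain ⟨φ, h, hφ, hmem, hh⟩ := exists_seq_of_mem_upperClosedLimit hj
  have hle : ∀ k s, symDiff (γ 0) (γ 1) s = 0 →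
      |(|γ 0 s - γ 1 s + τ (φ k) * (h k 0 s - h k 1 s)| -
        |γ 0 s + γ 1 s + τ (φ k) * (h k 0 s + h k 1 s)|)| ≤ 2 * q * τ (φ k) := by
    intro k s hs
    have h1 : s ∉ lowerCR (τ (φ k)) q
        (symDiff (⇑(toLinf (γ 0) + τ (φ k) • h k 0)) (⇑(toLinf (γ 1) + τ (φ k) • h k 1))) :=
      fun h2 => absurd hs (ne_of_lt ((hmem k).1 h2))
    have h3 : s ∉ upperCR (τ (φ k)) q
        (symDiff (⇑(toLinf (γ 0) + τ (φ k) • h k 0)) (⇑(toLinf (γ 1) + τ (φ k) • h k 1))) :=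
      fun h2 => absurd hs (ne_of_gt ((hmem k).2 h2))
    simp only [lowerCR, upperCR, mem_ofPred_eq, not_lt, symDiff_toLinf_add] at h1 h3
    rw [le_inv_mul_iff₀ (hτ _)] at h1
    rw [inv_mul_le_iff₀ (hτ _)] at h3
    exact abs_le.2 ⟨by linarith, by linarith⟩
  have hht : ∀ s m, Tendsto (fun k => h k m s) atTop (𝓝 (j m s)) := fun s m =>
    tendsto_apply_of_tendsto_toLinf (tendsto_pi_nhds.1 hh m) tendsto_const_nhds
  have hτφ : Tendsto (fun k => τ (φ k)) atTop (𝓝 0) := hτ₀.comp hφ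
  refine max_le (iSup_le fun i => iSup₂_le fun s hs => ?_) (iSup₂_le fun s hs => ?_)
  · rw [EReal.coe_le_coe_iff]
    have h0 : symDiff (γ 0) (γ 1) s = 0 := by fin_cases i <;> exact hs.1
    fin_cases i
    · obtain ⟨h1, h2⟩ := eq_zero_and_ne_zero_of_mem_R_zero hs
      refine abs_le_of_eventually_abs_le (l := atTop) (fun k => hτ (φ k)) hτφ (hht s 1) (hht s 0)
        h2 (Eventually.of_forall fun k => ?_)
      -- Here `y` is the second signal, so the difference has the opposite sign from the form in the
      -- lemma; the absolute value absorbs it.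
      convert hle k s h0 using 3
      · rw [h1, ← abs_neg]; congr 1; ring
      · rw [h1]; congr 1; ring
    · obtain ⟨h1, h2⟩ := eq_zero_and_ne_zero_of_mem_R_one hs
      refine abs_le_of_eventually_abs_le (l := atTop) (fun k => hτ (φ k)) hτφ (hht s 0) (hht s 1)
        h2 (Eventually.of_forall fun k => ?_)
      simpa only [h1, sub_zero, add_zero] using hle k s h0
  · rw [EReal.coe_le_coe_iff]
    obtain ⟨h1, h2⟩ := mem_V_zero_iff.1 hs
    have h3 : symDiff (γ 0) (γ 1) s = 0 := by rw [symDiff_eq, h1, h2]; simp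
    rw [symDiff_eq]
    change |(|j 0 s - j 1 s| - |j 0 s + j 1 s|) / 2| ≤ q
    have hlim := ((((hht s 0).sub (hht s 1)).abs.sub
      ((hht s 0).add (hht s 1)).abs).div_const 2).abs
    refine le_of_tendsto hlim (Eventually.of_forall fun k => ?_)
    have h4 := hle k s h3
    rw [h1, h2, zero_add, zero_add, abs_mul, abs_mul, ← mul_sub, abs_mul, abs_abs,
      abs_of_pos (hτ _)] at h4
    rw [abs_div, abs_two, div_le_iff₀ two_pos]
    exact le_of_mul_le_mul_left (by linarith) (hτ (φ k))

end Inclusion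

end SymDiffCR

/-! ### Passage from the deterministic limits to probabilities -/

theorem mainTheorem11 {S : Type*} [MetricSpace S] [CompactSpace S]
    {Ω : Type*} [MeasurableSpace Ω] (P : Measure Ω) [IsProbabilityMeasure P]
    (τ : ℕ → ℝ) (hτ_pos : ∀ n, 0 < τ n) (hτ_lim : Tendsto τ atTop (𝓝 0))
    (γ : Fin 2 → C(S, ℝ)) (γhat : ℕ → Ω → Fin 2 → SymDiffCR.Linf S)
    (J : Fin 2 → Ω → C(S, ℝ))
    (hCLT : SymDiffCR.WeaklyConverges P
      (fun n ω => SymDiffCR.errorProcess (τ n) (γhat n ω) γ)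
      (fun ω i => SymDiffCR.toLinf (J i ω)))
    (q : ℝ) :
    P {ω | SymDiffCR.lowerBoundStat (fun i => ⇑(γ i)) (fun i => ⇑(J i ω)) < (q : EReal)} ≤
      liminf (fun n => SymDiffCR.innerProb P
        (SymDiffCR.inclusionEvent (τ n) q (fun i => ⇑(γ i)) (γhat n))) atTop ∧
    limsup (fun n => SymDiffCR.outerProb P
        (SymDiffCR.inclusionEvent (τ n) q (fun i => ⇑(γ i)) (γhat n))) atTop ≤
      P {ω | SymDiffCR.upperBoundStat (fun i => ⇑(γ i)) (fun i => ⇑(J i ω)) ≤ (q : EReal)} := by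
  have hE : ∀ n, SymDiffCR.inclusionEvent (τ n) q (fun i => ⇑(γ i)) (γhat n) =
      (fun ω => SymDiffCR.errorProcess (τ n) (γhat n ω) γ) ⁻¹'
        SymDiffCR.inclusionSet (τ n) q γ := fun n =>
    (SymDiffCR.errorProcess_preimage_inclusionSet (hτ_pos n) q γ (γhat n)).symm
  simp only [hE]
  constructor
  · have h1 := hCLT.limsup_outerProb_le fun n => (SymDiffCR.inclusionSet (τ n) q γ)ᶜ
    have hmeas := hCLT.measurableSet_preimage_upperClosedLimit
      fun n => (SymDiffCR.inclusionSet (τ n) q γ)ᶜ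
    simp only [SymDiffCR.innerProb, ← preimage_compl]
    rw [ENNReal.liminf_const_sub _ _ ENNReal.one_ne_top]
    -- One minus the probability of the limiting failure set is the probability of its complement,
    -- as that set is measurable; the event of the statistic enters only through monotonicity.
    refine le_trans ?_ (tsub_le_tsub_left h1 1)
    rw [← prob_compl_eq_one_sub hmeas]
    exact measure_mono fun ω hω hω' => not_le.2 hω
      (SymDiffCR.le_lowerBoundStat_of_mem_upperClosedLimit hτ_pos hτ_lim hω')
  · exact (hCLT.limsup_outerProb_le _).trans (measure_mono fun ω hω =>
      SymDiffCR.upperBoundStat_le_of_mem_upperClosedLimit hτ_pos hτ_lim hω)
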